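/- All graphs are finite and simple. For a graph $H$ with adjacency matrix $A(H)$ and vertices $x,y$ of $H$: $H$ has perfect state transfer (PST) between $x$ and $y$ at time $t\in\mathbb R$ if $\exp(-itA(H))e_x=c\,e_y$ for some $c\in\mathbb C$ with $|c|=1$; $H$ has pretty good state transfer (PGST) between $x$ and $y$ if for every $\epsilon>0$ there is $t\in\mathbb R$ with $|\exp(-itA(H))_{xy}|>1-\epsilon$. The $\mathcal Q$-graph $\mathcal Q(G)$ of $G$ is obtained from $G$ by inserting a new vertex into each edge of $G$ and joining two new vertices by an edge whenever they lie on adjacent edges of $G$ (so the vertex set is $V(G)\cup E(G)$, each $a\in V(G)$ is adjacent exactly to the edges of $G$ incident with it, and two elements of $E(G)$ are adjacent exactly when they are distinct and share an end). Theorem 5.1. Let $G$ be a connected $r$-regular graph with $r\ge 2$, and let $u,v\in V(G)$. Let $\lambda_0$ be the largest eigenvalue of $A(G)$, let $S$ be the eigenvalue support of $u$, i.e. the set of eigenvalues $\lambda$ of $A(G)$ with $E_\lambda e_u\ne0$, where $E_\lambda$ is the orthogonal projection onto the $\lambda$-eigenspace, and let $$g=\gcd\Big\{\tfrac{\lambda_0-\lambda}{\sqrt\Delta}:\lambda\in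 S\Big\},$$ where $\Delta$ is a square-free positive integer for which all these quotients are integers. Assume that $G$ has PST between $u$ and $v$ at time $\pi/g$. (i) If $G$ is non-bipartite, then $\mathcal Q(G)$ has PGST between $u$ and $v$. (ii) If $G$ is bipartite and $r/g$ is an even integer, then $\mathcal Q(G)$ has PGST between $u$ and $v$. -/

import Mathlib

namespace QWalk

/-- The `𝒬`-graph of `G`: its vertices are the vertices of `G` (`Sum.inl`) together with one new
vertex for each edge of `G` (`Sum.inr`). An old vertex is adjacent to the new vertices on the edges
incident with it, and two new vertices are adjacent when their edges are adjacent (distinct with a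
common end) in `G`. -/
def qGraph {V : Type*} (G : SimpleGraph V) : SimpleGraph (V ⊕ G.edgeSet) where
  Adj x y :=
    match x, y with
    | Sum.inl _, Sum.inl _ => False
    | Sum.inl a, Sum.inr e => a ∈ (e : Sym2 V)
    | Sum.inr e, Sum.inl a => a ∈ (e : Sym2 V)
    | Sum.inr e, Sum.inr f => G.lineGraph.Adj e f
  symm := ⟨by
    rintro (a | e) (b | f) h
    · exact h
    · exact h
    · exact h
    · exact SimpleGraph.Adj.symm h⟩
  loopless := ⟨by
    rintro (a | e) h
    · exact h
    · exact SimpleGraph.irrefl _ h⟩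

noncomputable instance {V : Type*} (G : SimpleGraph V) : DecidableRel (qGraph G).Adj :=
  Classical.decRel _

/-- The transition matrix `exp(-i t A(G))` of the continuous-time quantum walk on `G`. -/
noncomputable def transitionMatrix {V : Type*} [Fintype V] [DecidableEq V] (G : SimpleGraph V)
    [DecidableRel G.Adj] (t : ℝ) : Matrix V V ℂ :=
  NormedSpace.exp ((-Complex.I * (t : ℂ)) • G.adjMatrix ℂ)

/-- Perfect state transfer on `G` between `u` and `v` at time `t`. -/
def HasPST {V : Type*} [Fintype V] [DecidableEq V] (G : SimpleGraph V) [DecidableRel G.Adj]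
    (u v : V) (t : ℝ) : Prop :=
  ∃ c : ℂ, ‖c‖ = 1 ∧
    (transitionMatrix G t).mulVec (Pi.single u 1) = c • (Pi.single v 1 : V → ℂ)

/-- Pretty good state transfer on `G` between `u` and `v`. -/
def HasPGST {V : Type*} [Fintype V] [DecidableEq V] (G : SimpleGraph V) [DecidableRel G.Adj]
    (u v : V) : Prop :=
  ∀ ε : ℝ, 0 < ε → ∃ t : ℝ, 1 - ε < ‖transitionMatrix G t u v‖

/-- The eigenprojector `E_μ`: the orthogonal projection of `ℝ^V` onto the `μ`-eigenspace of `A(G)`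
(it is zero if `μ` is not an eigenvalue). -/
noncomputable def eigenprojector {V : Type*} [Fintype V] [DecidableEq V] (G : SimpleGraph V)
    [DecidableRel G.Adj] (μ : ℝ) : EuclideanSpace ℝ V →L[ℝ] EuclideanSpace ℝ V :=
  (Module.End.eigenspace (Matrix.toEuclideanLin (G.adjMatrix ℝ)) μ).starProjection

/-- The eigenvalue support of a vertex `u`: the eigenvalues `μ` of `A(G)` with `E_μ e_u ≠ 0`. -/
def eigenvalueSupport {V : Type*} [Fintype V] [DecidableEq V] (G : SimpleGraph V)
    [DecidableRel G.Adj] (u : V) : Set ℝ :=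
  {μ | eigenprojector G μ (EuclideanSpace.single u 1) ≠ 0}

/-- `g` is the (nonnegative) greatest common divisor of a set `s` of real numbers all of which are
integers (integrality is the divisibility by `g` in the first clause). -/
def IsIntegerGcd (s : Set ℝ) (g : ℕ) : Prop :=
  (∀ x ∈ s, ∃ k : ℤ, x = (g : ℝ) * k) ∧
    ∀ d : ℕ, (∀ x ∈ s, ∃ k : ℤ, x = (d : ℝ) * k) → d ∣ g

/-- `g` is Coutinho's greatest common divisor at the vertex `u`:
`g = gcd {(λ₀ - μ) / √Δ : μ in the eigenvalue support of u}`, where `λ₀` is the largest eigenvalue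
of `G` and `Δ` is a square-free positive integer for which these quotients are integers. -/
def IsCoutinhoGcd {V : Type*} [Fintype V] [DecidableEq V] (G : SimpleGraph V)
    [DecidableRel G.Adj] (u : V) (g : ℕ) : Prop :=
  ∃ (Δ : ℕ) (lam0 : ℝ), Squarefree Δ ∧ IsGreatest (spectrum ℝ (G.adjMatrix ℝ)) lam0 ∧
    IsIntegerGcd ((fun μ : ℝ => (lam0 - μ) / √(Δ : ℝ)) '' eigenvalueSupport G u) g

end QWalk

/-! ### Square roots of integers with pairwise non-square products -/

/-! Let `R` be the incidence matrix. Since `R Rᵀ = A(G) + r` and `Rᵀ R` is `2` plus the adjacency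
matrix of the line graph, an eigenvector `w` of `G` for `l` lifts to eigenvectors of `𝒬(G)` for `(m
- 2 ± √(m² + 4)) / 2`, where `m = l + r`, and `(w, 0)` is a combination of the lifts. The walk
between old vertices is thus governed by the phases `exp(-it(m-2)/2) · exp(∓it√(m²+4)/2)`.

PST at time `π/g` gives `m = 2r - gK` and `w v = (-1)^K w u` on the support, so PGST follows once
some `t` brings all these phases near `γ (-1)^K` with a common unimodular `γ`. The time is chosen so
that the first factor equals `γ (-1)^(K+κ)` exactly, and Kronecker's theorem brings the second near
`(-1)^κ`: square roots of distinct squarefree integers are linearly independent over `ℚ`.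

Two obstructions remain. The number `m² + 4` is a square only for `m = 0`, which forces `G` to be
bipartite. If `g` is even in (ii), then `κ` has the parity of `K`, and values of `m² + 4` with the
same squarefree part must ask for the same parity; this is the descent
`two_pow_dvd_iff_of_mul_eq_sq`. -/

theorem trace_eq_zero_of_sq_eq {K : Type*} [Field K] [CharZero K] [Algebra ℚ K]
    [FiniteDimensional ℚ K] (x : K) (n : ℕ) (hx : x ^ 2 = (n : K)) (hn : ¬ IsSquare n) :
    Algebra.trace ℚ K x = 0 := by
  have hirr : Irreducible (Polynomial.X ^ 2 - Polynomial.C (n : ℚ)) := by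
    refine X_pow_sub_C_irreducible_of_prime Nat.prime_two fun b hb => hn ?_
    have : IsSquare (n : ℚ) := ⟨b, by rw [← hb, sq]⟩
    exact Rat.isSquare_natCast_iff.1 this
  have hmin : minpoly ℚ x = Polynomial.X ^ 2 - Polynomial.C (n : ℚ) := by
    refine (minpoly.eq_of_irreducible_of_monic hirr ?_ ?_).symm
    · simp [hx]
    · exact Polynomial.monic_X_pow_sub_C _ two_ne_zero
  rw [trace_eq_finrank_mul_minpoly_nextCoeff, hmin]
  have : (Polynomial.X ^ 2 - Polynomial.C (n : ℚ)).nextCoeff = 0 := by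
    rw [Polynomial.nextCoeff, Polynomial.natDegree_X_pow_sub_C]
    simp
  rw [this, neg_zero, mul_zero]

/-- Multiply the relation by `√(d i)` and take the trace to `ℚ`: every cross term is the square root
of a non-square, of trace zero, so only `c i * d i * [K : ℚ]` survives. -/
theorem eq_zero_of_sum_mul_sqrt_eq_zero {ι : Type*} [Fintype ι] (d : ι → ℕ)
    (hd : ∀ i j, i ≠ j → ¬ IsSquare (d i * d j)) (hpos : ∀ i, d i ≠ 0) (c : ι → ℚ)
    (h : ∑ i, (c i : ℝ) * √(d i : ℝ) = 0) (i : ι) : c i = 0 := by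
  classical
  let K := IntermediateField.adjoin ℚ (Set.range fun i => √(d i : ℝ))
  have hint : ∀ i, IsIntegral ℚ (√(d i : ℝ)) := fun i =>
    ⟨Polynomial.X ^ 2 - Polynomial.C (d i : ℚ), Polynomial.monic_X_pow_sub_C _ two_ne_zero, by simp⟩
  have : FiniteDimensional ℚ K :=
    IntermediateField.finiteDimensional_adjoin (by rintro _ ⟨i, rfl⟩; exact hint i)
  let s : ι → K := fun i => ⟨√(d i : ℝ), IntermediateField.subset_adjoin _ _ ⟨i, rfl⟩⟩
  have hs : ∀ i, s i ^ 2 = (d i : K) := fun i => by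
    apply Subtype.ext
    simp [s]
  have hK : ∑ j, c j • (s i * s j) = 0 := by
    have h0 : ∑ j, c j • s j = 0 := by
      apply Subtype.ext
      simpa [s, Algebra.smul_def] using h
    have : s i * ∑ j, c j • s j = 0 := by rw [h0, mul_zero]
    simpa [Finset.mul_sum] using this
  have htr := congrArg (Algebra.trace ℚ K) hK
  rw [map_sum, map_zero, Finset.sum_eq_single i] at htr
  · rw [map_smul, ← sq, hs, ← map_natCast (algebraMap ℚ K), Algebra.trace_algebraMap] at htr
    have h1 : Module.finrank ℚ K ≠ 0 := Module.finrank_pos.ne'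
    have h2 : (d i : ℚ) ≠ 0 := by exact_mod_cast hpos i
    simpa [h1, h2] using htr
  · intro j _ hj
    rw [map_smul, trace_eq_zero_of_sq_eq (s i * s j) (d i * d j) _ (hd i j hj.symm), smul_zero]
    rw [mul_pow, hs, hs]; push_cast; rfl
  · simp

theorem Squarefree.eq_of_isSquare_mul {a b : ℕ} (ha : Squarefree a) (hb : Squarefree b)
    (h : IsSquare (a * b)) : a = b := by
  obtain ⟨z, hz⟩ := h
  have h1 : a ∣ z := by
    rw [← ha.dvd_pow_iff_dvd two_ne_zero, sq, ← hz]; exact dvd_mul_right _ _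
  obtain ⟨w, rfl⟩ := h1
  have ha0 : a ≠ 0 := ha.ne_zero
  have h2 : b = a * (w * w) := by
    apply Nat.eq_of_mul_eq_mul_left (Nat.pos_of_ne_zero ha0); rw [hz]; ring
  have h3 : IsUnit w := hb w ⟨a, by rw [h2]; ring⟩
  rw [h2, Nat.isUnit_iff.1 h3]; simp

/-! ### Kronecker's approximation theorem -/

theorem tendsto_average_pow {z : ℂ} (hz : ‖z‖ = 1) (hz1 : z ≠ 1) :
    Filter.Tendsto (fun N : ℕ => (N : ℂ)⁻¹ * ∑ q ∈ Finset.range N, z ^ q) Filter.atTop (nhds 0) := by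
  have hz0 : 0 < ‖z - 1‖ := norm_pos_iff.2 (sub_ne_zero.2 hz1)
  refine squeeze_zero_norm (a := fun N : ℕ => (2 / ‖z - 1‖) * (N : ℝ)⁻¹) (fun N => ?_) ?_
  · rw [geom_sum_eq hz1, norm_mul, norm_inv, Complex.norm_natCast, norm_div, mul_comm]
    gcongr
    calc ‖z ^ N - 1‖ ≤ ‖z ^ N‖ + ‖(1 : ℂ)‖ := norm_sub_le _ _
      _ = 2 := by rw [norm_pow, hz]; norm_num
  · simpa using (tendsto_inv_atTop_nhds_zero_nat (𝕜 := ℝ)).const_mul (2 / ‖z - 1‖)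

instance UnitAddCircle.isProbabilityMeasure_volume :
    MeasureTheory.IsProbabilityMeasure (MeasureTheory.volume : MeasureTheory.Measure UnitAddCircle) :=
  ⟨UnitAddCircle.measure_univ⟩

open MeasureTheory UnitAddTorus in
-- Weyl equidistribution for trigonometric polynomials. On a nontrivial character the averages are
-- those of a geometric sequence with ratio `≠ 1`, and the integral vanishes because translation by
-- `α` multiplies it by that ratio.
theorem UnitAddTorus.tendsto_average_nsmul {ι : Type*} [Fintype ι] (α : UnitAddTorus ι)
    (hα : ∀ n : ι → ℤ, mFourier n α = 1 → n = 0) (f : C(UnitAddTorus ι, ℂ))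
    (hf : f ∈ Submodule.span ℂ (Set.range (mFourier (d := ι)))) :
    Filter.Tendsto (fun N : ℕ => (N : ℂ)⁻¹ * ∑ q ∈ Finset.range N, f (q • α)) Filter.atTop
      (nhds (∫ x, f x)) := by
  have hint : ∀ g : C(UnitAddTorus ι, ℂ), Integrable g := fun g =>
    g.continuous.integrable_of_hasCompactSupport (HasCompactSupport.of_compactSpace _)
  have hadd : ∀ (n : ι → ℤ) (x y : UnitAddTorus ι),
      mFourier n (x + y) = mFourier n x * mFourier n y := fun n x y => by
    simp [mFourier, Finset.prod_mul_distrib, AddCircle.toCircle_add]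
  have hmul : ∀ (n : ι → ℤ) (q : ℕ), mFourier n (q • α) = mFourier n α ^ q := fun n q => by
    induction q with
    | zero => simp [mFourier]
    | succ q ih => rw [succ_nsmul, hadd, ih, pow_succ]
  induction hf using Submodule.span_induction with
  | mem f hf =>
    obtain ⟨n, rfl⟩ := hf
    by_cases hn : n = 0
    · subst hn
      simp only [mFourier_zero, ContinuousMap.one_apply, Finset.sum_const, Finset.card_range,
        nsmul_eq_mul, mul_one, integral_const, probReal_univ, one_smul]
      refine tendsto_const_nhds.congr' ?_
      filter_upwards [Filter.eventually_ne_atTop 0] with N hN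
      rw [inv_mul_cancel₀ (by exact_mod_cast hN)]
    · have hne : mFourier n α ≠ 1 := fun h => hn (hα n h)
      have h0 : ∫ x, mFourier n x = 0 := by
        have h1 : ∫ x, mFourier n (x + α) = ∫ x, mFourier n x :=
          integral_add_right_eq_self (fun x => mFourier n x) α
        simp_rw [hadd] at h1
        rw [integral_mul_const] at h1
        have h2 : (∫ x, mFourier n x) * (mFourier n α - 1) = 0 := by
          rw [mul_sub, h1]; ring
        exact (mul_eq_zero.1 h2).resolve_right (sub_ne_zero.2 hne)
      rw [h0]
      simp_rw [hmul]
      refine tendsto_average_pow ?_ hne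
      simp [mFourier, Circle.norm_coe]
  | zero => simp
  | add f g _ _ hf hg =>
    simp only [ContinuousMap.add_apply, Finset.sum_add_distrib, mul_add]
    rw [integral_add (hint f) (hint g)]
    exact hf.add hg
  | smul c f _ hf =>
    simp only [ContinuousMap.smul_apply, smul_eq_mul, ← Finset.mul_sum]
    rw [integral_const_mul]
    simpa [mul_left_comm] using hf.const_mul c

open MeasureTheory UnitAddTorus in
-- If the orbit missed the `δ`-ball at `β`, a bump function supported there would vanish along the
-- orbit and yet have positive integral `c`. A trigonometric polynomial within `c / 4` of it then
-- yields `c ≤ c / 2`.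
theorem UnitAddTorus.exists_nsmul_dist_lt {ι : Type*} [Fintype ι] (α β : UnitAddTorus ι)
    (hα : ∀ n : ι → ℤ, mFourier n α = 1 → n = 0) {δ : ℝ} (hδ : 0 < δ) :
    ∃ q : ℕ, dist (q • α) β < δ := by
  by_contra! hfar
  let F : UnitAddTorus ι → ℝ := fun x => max 0 (δ - dist x β)
  have hFc : Continuous F := by fun_prop
  have hFi : Integrable F :=
    hFc.integrable_of_hasCompactSupport (HasCompactSupport.of_compactSpace _)
  have hpos : 0 < ∫ x, F x := by
    refine hFc.integral_pos_of_hasCompactSupport_nonneg_nonzero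
      (HasCompactSupport.of_compactSpace _) (fun x => le_max_left _ _) (x := β) ?_
    simp [F, hδ.ne', hδ.le]
  set c := ∫ x, F x with hc
  let f : C(UnitAddTorus ι, ℂ) := ⟨fun x => (F x : ℂ), by fun_prop⟩
  have hfint : ∫ x, f x = (c : ℂ) := integral_ofReal
  have hf0 : ∀ q : ℕ, f (q • α) = 0 := fun q => by
    simp [f, F, hfar q]
  have hmem : f ∈ closure (Submodule.span ℂ (Set.range (mFourier (d := ι))) :
      Set C(UnitAddTorus ι, ℂ)) := by
    rw [← Submodule.topologicalClosure_coe, span_mFourier_closure_eq_top]; trivial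
  obtain ⟨h, hh, hfh⟩ := Metric.mem_closure_iff.1 hmem (c / 4) (by positivity)
  have hb : ∀ x, ‖f x - h x‖ ≤ c / 4 := fun x => by
    rw [← dist_eq_norm]; exact (ContinuousMap.dist_apply_le_dist x).trans hfh.le
  have hlim := (tendsto_average_nsmul α hα h hh).norm
  have h1 : ‖∫ x, h x‖ ≤ c / 4 := by
    refine le_of_tendsto hlim (Filter.Eventually.of_forall fun N => ?_)
    rw [norm_mul, norm_inv, Complex.norm_natCast]
    have : ‖∑ q ∈ Finset.range N, h (q • α)‖ ≤ N * (c / 4) := by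
      refine (norm_sum_le_of_le (f := fun q => h (q • α)) _ (fun q _ => ?_)).trans_eq
        (b := ∑ q ∈ Finset.range N, c / 4) ?_
      · simpa [hf0] using hb (q • α)
      · simp
    rcases N.eq_zero_or_pos with rfl | hN
    · simp; positivity
    · rw [inv_mul_le_iff₀ (by exact_mod_cast hN)]; exact this
  have hint : ∀ g : C(UnitAddTorus ι, ℂ), Integrable g := fun g =>
    g.continuous.integrable_of_hasCompactSupport (HasCompactSupport.of_compactSpace _)
  have h2 : ‖∫ x, (f x - h x)‖ ≤ c / 4 := by
    simpa using norm_integral_le_of_norm_le_const (μ := volume) (Filter.Eventually.of_forall hb)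
  rw [integral_sub (hint f) (hint h), hfint] at h2
  have h3 : ‖(c : ℂ)‖ ≤ c / 4 + c / 4 := by
    calc ‖(c : ℂ)‖ = ‖((c : ℂ) - ∫ x, h x) + ∫ x, h x‖ := by ring_nf
      _ ≤ _ := (norm_add_le _ _).trans (add_le_add h2 h1)
  rw [Complex.norm_real, Real.norm_of_nonneg hpos.le] at h3
  linarith

/-- **Kronecker's approximation theorem**, with natural number multipliers. -/
theorem exists_nat_mul_near_int {ι : Type*} [Fintype ι] (α β : ι → ℝ)
    (hα : ∀ (n : ι → ℤ) (k : ℤ), ∑ i, (n i : ℝ) * α i = k → n = 0) {δ : ℝ} (hδ : 0 < δ) :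
    ∃ q : ℕ, ∀ i, ∃ p : ℤ, |q * α i - β i - p| < δ := by
  have hchar : ∀ n : ι → ℤ, UnitAddTorus.mFourier n (fun i => (α i : UnitAddCircle)) = 1 → n = 0 := by
    intro n hn
    have h1 : UnitAddTorus.mFourier n (fun i => (α i : UnitAddCircle))
        = Complex.exp ((∑ i, (n i : ℝ) * α i : ℝ) * (2 * Real.pi * Complex.I)) := by
      simp only [UnitAddTorus.mFourier, ContinuousMap.coe_mk, fourier_coe_apply]
      rw [← Complex.exp_sum]
      congr 1
      push_cast
      rw [Finset.sum_mul]
      refine Finset.sum_congr rfl fun i _ => ?_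
      ring
    rw [h1, Complex.exp_eq_one_iff] at hn
    obtain ⟨k, hk⟩ := hn
    have h3 := mul_right_cancel₀ Complex.two_pi_I_ne_zero hk
    exact hα n k (by exact_mod_cast h3)
  obtain ⟨q, hq⟩ := UnitAddTorus.exists_nsmul_dist_lt (fun i => (α i : UnitAddCircle))
    (fun i => (β i : UnitAddCircle)) hchar hδ
  refine ⟨q, fun i => ⟨round (q * α i - β i), ?_⟩⟩
  have h1 := (dist_le_pi_dist _ _ i).trans_lt hq
  rw [dist_eq_norm] at h1
  have h2 : (q • fun i => (α i : UnitAddCircle)) i - (β i : UnitAddCircle)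
      = ((q * α i - β i : ℝ) : UnitAddCircle) := by
    simp [← nsmul_eq_mul]
  rw [h2, UnitAddCircle.norm_eq] at h1
  exact h1

/-- Kronecker approximation for the square roots of distinct squarefree numbers, with a rational
scaling. -/
theorem exists_nat_mul_sqrt_near_int (D : Finset ℕ) (hD : ∀ d ∈ D, Squarefree d ∧ d ≠ 1)
    {g : ℕ} (hg : g ≠ 0) (β : ℕ → ℝ) {δ : ℝ} (hδ : 0 < δ) :
    ∃ q : ℕ, ∀ d ∈ D, ∃ p : ℤ, |q * (√(d : ℝ) / g) - β d - p| < δ := by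
  have hg' : (g : ℝ) ≠ 0 := by exact_mod_cast hg
  have hindep : ∀ (n : D → ℤ) (k : ℤ), ∑ d, (n d : ℝ) * (√((d : ℕ) : ℝ) / g) = k → n = 0 := by
    intro n k hnk
    -- The extra index `none`, with value `1`, absorbs the integer `k` into the relation among
    -- square roots.
    let e : Option D → ℕ := fun o => o.elim 1 (fun d => d)
    have hsf : ∀ o, Squarefree (e o) := by
      rintro (_ | d)
      · exact squarefree_one
      · exact (hD d d.2).1
    have hinj : Function.Injective e := by
      rintro (_ | a) (_ | b) h
      · rfl
      · exact absurd h.symm (hD b b.2).2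
      · exact absurd h (hD a a.2).2
      · exact congrArg some (Subtype.ext h)
    have := eq_zero_of_sum_mul_sqrt_eq_zero e
      (fun i j hij hsq => hij (hinj ((hsf i).eq_of_isSquare_mul (hsf j) hsq)))
      (fun i => (hsf i).ne_zero) (fun o => o.elim (-(k * g : ℚ)) (fun d => (n d : ℚ))) (by
        rw [Fintype.sum_option]
        simp only [Option.elim, e]
        push_cast
        rw [← hnk]
        simp only [Real.sqrt_one, mul_one, Finset.sum_mul]
        rw [neg_add_eq_sub, sub_eq_zero]
        refine Finset.sum_congr rfl fun d _ => ?_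
        field_simp)
    funext d
    simpa using this (some d)
  obtain ⟨q, hq⟩ := exists_nat_mul_near_int (ι := D) (fun d => √((d : ℕ) : ℝ) / g) (fun d => β d)
    hindep hδ
  exact ⟨q, fun d hd => hq ⟨d, hd⟩⟩

/-! ### Squarefree parts of `x ^ 2 + 1` and `m ^ 2 + 4` -/

/-- Descent on `x + y`. For fixed `x` this is the Pell-type equation `z² - (x²+1) y² = x² + 1`; the
unit `2x² + 1 + 2x√(x²+1)` replaces the larger `y` by a smaller solution and controls divisibility
by powers of `2`. -/
theorem two_pow_dvd_iff_of_mul_eq_sq (N : ℕ) : ∀ x y z : ℤ, 0 < x → 0 < y → x + y ≤ N →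
    (x ^ 2 + 1) * (y ^ 2 + 1) = z ^ 2 → ∀ n : ℕ, (2 : ℤ) ^ n ∣ x ↔ (2 : ℤ) ^ n ∣ y := by
  induction N with
  | zero => intro x y z hx hy h; push_cast at h; omega
  | succ N ih =>
    have key : ∀ x y z : ℤ, 0 < x → 0 < z → x < y → x + y ≤ N + 1 →
        (x ^ 2 + 1) * (y ^ 2 + 1) = z ^ 2 → ∀ n : ℕ, (2 : ℤ) ^ n ∣ x ↔ (2 : ℤ) ^ n ∣ y := by
      intro x y z hx hz hxy hN h n
      have hy : 0 < y := hx.trans hxy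
      set w := y * (2 * x ^ 2 + 1) - 2 * x * z with hw
      have hlt : w < y := by
        have : x * y < z := by
          refine lt_of_pow_lt_pow_left₀ 2 hz.le ?_
          rw [← h]; nlinarith
        rw [hw]; nlinarith
      have hgt : -y < w := by
        have h1 : x * z < y * (x ^ 2 + 1) := by
          refine lt_of_pow_lt_pow_left₀ 2 (by positivity) ?_
          rw [mul_pow, ← h, mul_pow]
          have h2 : x ^ 2 * (y ^ 2 + 1) < y ^ 2 * (x ^ 2 + 1) := by nlinarith
          have h3 : 0 < x ^ 2 + 1 := by positivity
          nlinarith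
        rw [hw]; nlinarith
      have hne : w ≠ 0 := by
        intro h0
        have h1 : y * (2 * x ^ 2 + 1) = 2 * x * z := by rw [hw] at h0; linarith
        -- This square would lie strictly between `(2x²)²` and `(2x²+1)²`.
        have h2 : y ^ 2 = (4 * x ^ 2) * (x ^ 2 + 1) := by
          have h3 : y ^ 2 * (2 * x ^ 2 + 1) ^ 2 = 4 * x ^ 2 * ((x ^ 2 + 1) * (y ^ 2 + 1)) := by
            rw [h, ← mul_pow, h1]; ring
          linear_combination h3
        have h4 : 2 * x ^ 2 < y := by
          refine lt_of_pow_lt_pow_left₀ 2 hy.le ?_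
          rw [h2]; nlinarith [sq_pos_of_pos hx]
        have h5 : y < 2 * x ^ 2 + 1 := by
          refine lt_of_pow_lt_pow_left₀ 2 (by positivity) ?_
          rw [h2]; nlinarith
        omega
      have hrec := ih x |w| (z * (2 * x ^ 2 + 1) - 2 * x * (x ^ 2 + 1) * y) hx (abs_pos.2 hne)
        (by have : |w| < y := abs_lt.2 ⟨hgt, hlt⟩
            omega)
        (by rw [sq_abs, hw]; linear_combination h)
      have hstep : ∀ k : ℕ, (2 : ℤ) ^ k ∣ 2 * x → ((2 : ℤ) ^ k ∣ |w| ↔ (2 : ℤ) ^ k ∣ y) := by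
        intro k hk
        rw [dvd_abs, hw, dvd_sub_left (hk.mul_right z)]
        have hco : IsCoprime ((2 : ℤ) ^ k) (2 * x ^ 2 + 1) :=
          IsCoprime.pow_left ⟨-x ^ 2, 1, by ring⟩
        exact ⟨fun h' => hco.dvd_of_dvd_mul_right h', fun h' => h'.mul_right _⟩
      constructor
      · intro hn
        exact (hstep n (hn.mul_left 2)).1 ((hrec n).1 hn)
      -- `hstep` at exponent `k + 1` only needs `2^k ∣ x`, so divisibility of `x` is gained one
      -- power at a time.
      · induction n with
        | zero => simp
        | succ k ihk =>
          intro hk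
          have h1 : (2 : ℤ) ^ k ∣ x := ihk ((pow_dvd_pow 2 k.le_succ).trans hk)
          have h2 : (2 : ℤ) ^ (k + 1) ∣ 2 * x := by
            rw [pow_succ']; exact mul_dvd_mul_left 2 h1
          exact (hrec (k + 1)).2 ((hstep (k + 1) h2).2 hk)
    intro x y z hx hy hN h n
    have hz : z ≠ 0 := by
      rintro rfl
      have : 0 < (x ^ 2 + 1) * (y ^ 2 + 1) := by positivity
      rw [h] at this; simp at this
    rw [← sq_abs z] at h
    push_cast at hN
    rcases lt_trichotomy x y with hlt | rfl | hlt
    · exact key x y |z| hx (abs_pos.2 hz) hlt hN h n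
    · rfl
    · exact (key y x |z| hy (abs_pos.2 hz) hlt (by omega) (by rw [← h]; ring) n).symm

/-- If `2^v` is the exact power of `2` in `h`, then `k` is even iff `2^(v+1) ∣ h k`. -/
theorem even_of_even_of_mul_eq_sq {h : ℕ} (hh : h ≠ 0) {k l : ℤ} (hk : k ≠ 0) (hl : l ≠ 0) {z : ℤ}
    (hz : (((h : ℤ) * k) ^ 2 + 1) * (((h : ℤ) * l) ^ 2 + 1) = z ^ 2) (he : Even k) : Even l := by
  obtain ⟨v, c, hc, rfl⟩ := Nat.exists_eq_two_pow_mul_odd hh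
  have hc0 : c ≠ 0 := by rintro rfl; simp at hc
  have hpos : ∀ j : ℤ, j ≠ 0 → 0 < |((2 ^ v * c : ℕ) : ℤ) * j| := fun j hj => by positivity
  have h1 := (two_pow_dvd_iff_of_mul_eq_sq (|((2 ^ v * c : ℕ) : ℤ) * k| +
    |((2 ^ v * c : ℕ) : ℤ) * l|).toNat _ _ z (hpos k hk) (hpos l hl) (Int.self_le_toNat _)
    (by rw [sq_abs, sq_abs, hz]) (v + 1)).1 (by
      rw [dvd_abs, pow_succ]
      obtain ⟨j, rfl⟩ := he
      exact ⟨c * j, by push_cast; ring⟩)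
  rw [dvd_abs, pow_succ] at h1
  push_cast at h1
  rw [mul_assoc] at h1
  have h2 := Int.dvd_of_mul_dvd_mul_left (by positivity) h1
  rw [← even_iff_two_dvd, Int.even_mul] at h2
  refine h2.resolve_left ?_
  rw [Int.not_even_iff_odd]; exact_mod_cast hc

theorem exists_sq_mul_squarefree (n : ℕ) : ∃ a d : ℕ, n = a ^ 2 * d ∧ (n ≠ 0 → Squarefree d) := by
  obtain ⟨d, a, h, hs⟩ := Nat.sq_mul_squarefree n
  exact ⟨a, d, h.symm, fun _ => hs⟩

/-- Simultaneous approximation modulo `1` of the numbers `q √n / g` for non-square `n`, with targets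
`a β(d)` where `n = a ^ 2 d` with `d` squarefree. -/
theorem exists_nat_mul_sqrt_near_int' (M : Finset ℤ) (a d : ℤ → ℕ) (hd : ∀ m ∈ M, Squarefree (d m))
    {g : ℕ} (hg : g ≠ 0) (β : ℕ → ℝ) {δ : ℝ} (hδ : 0 < δ) :
    ∃ q : ℕ, ∀ m ∈ M, d m ≠ 1 → ∃ p : ℤ,
      |q * (a m * √(d m : ℝ) / g) - a m * β (d m) - a m * p| < δ := by
  have hC : ∀ m ∈ M, a m ≤ ∑ m ∈ M, a m := fun m hm =>
    Finset.single_le_sum (f := a) (fun _ _ => Nat.zero_le _) hm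
  set C := ∑ m ∈ M, a m
  -- The tolerance `δ / (C + 1)` survives multiplication by any `a m ≤ C`. The value `d = 1` is
  -- excluded since `√1` is rational.
  obtain ⟨q, hq⟩ := exists_nat_mul_sqrt_near_int ((M.image d).filter (· ≠ 1))
    (by
      intro e he
      obtain ⟨h1, h2⟩ := Finset.mem_filter.1 he
      obtain ⟨m, hm, rfl⟩ := Finset.mem_image.1 h1
      exact ⟨hd m hm, h2⟩) hg β (δ := δ / (C + 1)) (by positivity)
  refine ⟨q, fun m hm h1 => ?_⟩
  obtain ⟨p, hp⟩ := hq (d m) (Finset.mem_filter.2 ⟨Finset.mem_image_of_mem d hm, h1⟩)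
  refine ⟨p, ?_⟩
  have h2 : q * (a m * √(d m : ℝ) / g) - a m * β (d m) - a m * p
      = a m * (q * (√(d m : ℝ) / g) - β (d m) - p) := by ring
  rw [h2, abs_mul, Nat.abs_cast]
  have h3 : (a m : ℝ) ≤ C := by exact_mod_cast hC m hm
  have h4 : (0 : ℝ) < C + 1 := by positivity
  rw [lt_div_iff₀ h4] at hp
  nlinarith [abs_nonneg (q * (√(d m : ℝ) / g) - β (d m) - p)]

theorem Int.eq_zero_of_sq_add_four_eq_sq {m a : ℤ} (h : m ^ 2 + 4 = a ^ 2) : m = 0 := by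
  by_contra hm
  have hm1 : 1 ≤ |m| := Int.one_le_abs hm
  rw [← sq_abs m, ← sq_abs a] at h
  have h1 : |m| < |a| := lt_of_pow_lt_pow_left₀ 2 (abs_nonneg a) (by omega)
  have h2 : |a| < |m| + 2 := lt_of_pow_lt_pow_left₀ 2 (by positivity) (by nlinarith)
  have h3 : |a| = |m| + 1 := by omega
  rw [h3] at h
  have : 2 * |m| = 3 := by linarith
  omega

/-- A common odd multiple of the numbers `√(m ^ 2 + 4) / (2 g)` which is close to an integer. -/
theorem exists_odd_mul_sqrt_near_int (M : Finset ℤ) {g : ℕ} (hg : g ≠ 0)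
    (hM : ∀ m ∈ M, m = 0 → g = 1) {δ : ℝ} (hδ : 0 < δ) :
    ∃ p : ℕ, ∀ m ∈ M, ∃ n : ℤ, |(2 * p + 1) * √((m : ℝ) ^ 2 + 4) / (2 * g) - n| < δ := by
  choose a d had hsf using fun m : ℤ => exists_sq_mul_squarefree (m.natAbs ^ 2 + 4)
  have hsqrt : ∀ m : ℤ, √((m : ℝ) ^ 2 + 4) = a m * √(d m : ℝ) := fun m => by
    have h1 : (m : ℝ) ^ 2 + 4 = (a m : ℝ) ^ 2 * d m := by
      rw [← Int.cast_pow, ← Int.natAbs_sq m]; exact_mod_cast had m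
    rw [h1, Real.sqrt_mul (by positivity), Real.sqrt_sq (by positivity)]
  -- The target `-√d / (2g)` turns multiples `p / g` into odd multiples `(2p + 1) / (2g)`.
  obtain ⟨p, hp⟩ := exists_nat_mul_sqrt_near_int' M a d (fun m _ => hsf m (by positivity)) hg
    (fun d => -(√(d : ℝ) / (2 * g))) hδ
  refine ⟨p, fun m hm => ?_⟩
  by_cases h1 : d m = 1
  · have h2 : (m : ℤ) ^ 2 + 4 = (a m : ℤ) ^ 2 := by
      have := had m
      rw [h1, mul_one] at this
      rw [← Int.natAbs_sq m]; exact_mod_cast this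
    have h0 := Int.eq_zero_of_sq_add_four_eq_sq h2
    refine ⟨2 * p + 1, ?_⟩
    have h4 : √(4 : ℝ) = 2 := by
      rw [show (4 : ℝ) = 2 ^ 2 by norm_num]; exact Real.sqrt_sq (by norm_num)
    rw [hM m hm h0, h0]
    simp [h4, hδ]
  · obtain ⟨n, hn⟩ := hp m hm h1
    refine ⟨a m * n, ?_⟩
    rw [hsqrt]
    push_cast
    convert hn using 2
    have hg' : (g : ℝ) ≠ 0 := by exact_mod_cast hg
    field_simp
    ring

/-- A common multiple of the numbers `√((h k) ^ 2 + 1)` which is close to an integer for even `k`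
and to a half-integer for odd `k`. -/
theorem exists_mul_sqrt_near_half (M : Finset ℤ) {h : ℕ} (hh : h ≠ 0) {δ : ℝ} (hδ : 0 < δ) :
    ∃ q : ℕ, ∀ k ∈ M, ∃ n : ℤ, |q * √(((h : ℝ) * k) ^ 2 + 1) - k / 2 - n| < δ := by
  classical
  choose a d had hsf using fun k : ℤ => exists_sq_mul_squarefree ((h * k.natAbs) ^ 2 + 1)
  have hadz : ∀ k : ℤ, ((h : ℤ) * k) ^ 2 + 1 = (a k : ℤ) ^ 2 * d k := fun k => by
    have := had k
    zify at this
    rw [← this, mul_pow, mul_pow, sq_abs]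
  have hsqrt : ∀ k : ℤ, √(((h : ℝ) * k) ^ 2 + 1) = a k * √(d k : ℝ) := fun k => by
    have h1 : ((h : ℝ) * k) ^ 2 + 1 = (a k : ℝ) ^ 2 * d k := by exact_mod_cast hadz k
    rw [h1, Real.sqrt_mul (by positivity), Real.sqrt_sq (by positivity)]
  -- A number `x² + 1` is never divisible by `4`. Oddness of `a k` makes `a k * (1/2)` a
  -- half-integer, so a target `1/2` for `√d` serves every odd `k` with that `d`.
  have hodd : ∀ k, Odd (a k : ℤ) := fun k => by
    rw [← Int.not_even_iff_odd]
    rintro ⟨c, hc⟩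
    have h1 := hadz k
    rw [hc] at h1
    have h2 : (((h : ℤ) * k) ^ 2 + 1) % 4 = 0 := by
      rw [h1, show (c + c) ^ 2 * (d k : ℤ) = 4 * (c ^ 2 * d k) by ring]; simp
    rcases Int.even_or_odd ((h : ℤ) * k) with ⟨e, he⟩ | ⟨e, he⟩
    · rw [he] at h2; ring_nf at h2; omega
    · rw [he] at h2; ring_nf at h2; omega
  have hzero : ∀ k, d k = 1 → k = 0 := fun k h1 => by
    have h2 := hadz k
    rw [h1] at h2
    have h3 := Int.eq_zero_of_sq_add_four_eq_sq (m := 2 * ((h : ℤ) * k)) (a := 2 * a k) (by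
      push_cast at h2; linear_combination 4 * h2)
    simpa [hh] using h3
  obtain ⟨q, hq⟩ := exists_nat_mul_sqrt_near_int' M a d (fun m _ => hsf m (by positivity))
    one_ne_zero (fun e => if ∃ k ∈ M, d k = e ∧ Odd k then (1 / 2 : ℝ) else 0) hδ
  refine ⟨q, fun k hk => ?_⟩
  by_cases h1 : d k = 1
  · refine ⟨q, ?_⟩
    rw [hzero k h1]
    simp [hδ]
  obtain ⟨p, hp⟩ := hq k hk h1
  rw [hsqrt]
  rcases Int.even_or_odd k with he | ho
  · rw [if_neg] at hp
    · obtain ⟨c, hc⟩ := he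
      refine ⟨a k * p - c, ?_⟩
      convert hp using 2
      rw [hc]
      push_cast
      ring
    -- No odd `l` shares its squarefree part with the even `k`: the product of the two numbers would
    -- be a square.
    · rintro ⟨l, hl, hdl, hlo⟩
      have hk0 : k ≠ 0 := by
        rintro rfl
        have h2 := had 0
        simp only [Int.natAbs_zero, mul_zero] at h2
        exact h1 (Nat.eq_one_of_mul_eq_one_left (by simpa using h2.symm))
      have hl0 : l ≠ 0 := by rintro rfl; simp at hlo
      refine Int.not_even_iff_odd.2 hlo (even_of_even_of_mul_eq_sq hh hk0 hl0
        (z := a k * a l * d k) ?_ he)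
      rw [hadz, hadz, hdl]; ring
  · rw [if_pos ⟨k, hk, rfl, ho⟩] at hp
    obtain ⟨c, hc⟩ := ho
    obtain ⟨b, hb⟩ := hodd k
    have hb' : (a k : ℝ) = 2 * b + 1 := by exact_mod_cast hb
    refine ⟨a k * p + b - c, ?_⟩
    convert hp using 2
    have hc' : (k : ℝ) = 2 * c + 1 := by exact_mod_cast hc
    push_cast
    linear_combination hb' / 2 - hc' / 2

/-! ### Exponentials of matrices and eigenvectors -/

open Matrix in
theorem Matrix.exp_smul_mulVec_of_mulVec_eq {n : Type*} [Fintype n] [DecidableEq n]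
    (M : Matrix n n ℂ) (c θ : ℂ) (y : n → ℂ) (h : M *ᵥ y = θ • y) :
    NormedSpace.exp (c • M) *ᵥ y = Complex.exp (c * θ) • y := by
  let : NormedRing (Matrix n n ℂ) := Matrix.linftyOpNormedRing
  let : NormedAlgebra ℂ (Matrix n n ℂ) := Matrix.linftyOpNormedAlgebra
  have hpow : ∀ k : ℕ, (c • M) ^ k *ᵥ y = (c * θ) ^ k • y := fun k => by
    induction k with
    | zero => simp
    | succ k ih =>
      rw [pow_succ, ← mulVec_mulVec, smul_mulVec, h, smul_smul, mulVec_smul, ih, smul_smul, pow_succ]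
      congr 1; ring
  have h1 := NormedSpace.exp_series_hasSum_exp' (𝕂 := ℂ) (c • M)
  have hc : Continuous fun N : Matrix n n ℂ => N *ᵥ y :=
    Continuous.matrix_mulVec continuous_id continuous_const
  have h2 := h1.map ((Matrix.mulVecBilin ℂ ℂ).flip y : Matrix n n ℂ →ₗ[ℂ] (n → ℂ)) hc
  have h3 := (NormedSpace.exp_series_hasSum_exp' (𝕂 := ℂ) (c * θ)).smul_const y
  rw [← Complex.exp_eq_exp_ℂ] at h3
  refine h2.unique (h3.congr_fun fun k => ?_)
  simp [hpow, smul_smul]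

/-! ### The spectrum of `𝒬(G)` through the incidence matrix. -/

namespace QWalk

open Matrix

/-- The vertex-edge incidence matrix, with columns indexed by the edges. -/
noncomputable def incidence {V : Type*} (G : SimpleGraph V) : Matrix V G.edgeSet ℂ :=
  open Classical in Matrix.of fun a e => if a ∈ (e : Sym2 V) then 1 else 0

section

variable {V : Type*} (G : SimpleGraph V)

theorem qGraph_adj_inl_inl (a b : V) : (qGraph G).Adj (Sum.inl a) (Sum.inl b) ↔ False := Iff.rfl

theorem qGraph_adj_inl_inr (a : V) (e : G.edgeSet) :
    (qGraph G).Adj (Sum.inl a) (Sum.inr e) ↔ a ∈ (e : Sym2 V) := Iff.rfl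

theorem qGraph_adj_inr_inl (a : V) (e : G.edgeSet) :
    (qGraph G).Adj (Sum.inr e) (Sum.inl a) ↔ a ∈ (e : Sym2 V) := Iff.rfl

theorem qGraph_adj_inr_inr (e f : G.edgeSet) :
    (qGraph G).Adj (Sum.inr e) (Sum.inr f) ↔ G.lineGraph.Adj e f := Iff.rfl

theorem sum_incidence_mul [Fintype V] (e : G.edgeSet) (h : V → ℂ) {p q : V}
    (he : (e : Sym2 V) = s(p, q)) : ∑ a, incidence G a e * h a = h p + h q := by
  classical
  have hpq : p ≠ q := by
    have := e.2
    rw [he, SimpleGraph.mem_edgeSet] at this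
    exact this.ne
  rw [← Finset.sum_subset (Finset.subset_univ {p, q}), Finset.sum_pair hpq]
  · simp [incidence, he]
  · intro a _ ha
    simp only [Finset.mem_insert, Finset.mem_singleton] at ha
    simp [incidence, he, ha]

theorem transpose_incidence_mul [Fintype V] [Fintype G.edgeSet] [DecidableEq G.edgeSet]
    [DecidableRel G.lineGraph.Adj] :
    (incidence G)ᵀ * incidence G = (2 : ℂ) • 1 + G.lineGraph.adjMatrix ℂ := by
  ext e f
  obtain ⟨p, q, hpq⟩ : ∃ p q, (e : Sym2 V) = s(p, q) :=
    Sym2.ind (fun p q => ⟨p, q, rfl⟩) (e : Sym2 V)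
  have hne : p ≠ q := by
    have := e.2
    rw [hpq, SimpleGraph.mem_edgeSet] at this
    exact this.ne
  have hboth := Sym2.mem_and_mem_iff (z := (f : Sym2 V)) hne
  have hef : (f : Sym2 V) = s(p, q) ↔ e = f := by
    rw [← hpq, Subtype.ext_iff, eq_comm]
  have hadj : G.lineGraph.Adj e f ↔ e ≠ f ∧ (p ∈ (f : Sym2 V) ∨ q ∈ (f : Sym2 V)) := by
    simp [SimpleGraph.lineGraph_adj_iff_exists, hpq]
  rw [Matrix.mul_apply]
  simp only [Matrix.transpose_apply]
  rw [sum_incidence_mul G e (fun a => incidence G a f) hpq]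
  simp only [incidence, Matrix.of_apply, Matrix.add_apply, Matrix.smul_apply, Matrix.one_apply,
    SimpleGraph.adjMatrix_apply, hadj]
  rw [hef] at hboth
  by_cases h : e = f
  · obtain ⟨h1, h2⟩ := hboth.2 h
    simp [h, h1, h2]; norm_num
  · by_cases h1 : p ∈ (f : Sym2 V) <;> by_cases h2 : q ∈ (f : Sym2 V) <;> simp_all

theorem adjMatrix_qGraph_mulVec [Fintype V] [Fintype G.edgeSet] (x : V → ℂ) (y : G.edgeSet → ℂ) :
    (qGraph G).adjMatrix ℂ *ᵥ Sum.elim x y =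
      Sum.elim (incidence G *ᵥ y)
        ((incidence G)ᵀ *ᵥ x + (incidence G)ᵀ *ᵥ (incidence G *ᵥ y) - (2 : ℂ) • y) := by
  classical
  have hL : (incidence G)ᵀ *ᵥ (incidence G *ᵥ y) - (2 : ℂ) • y = G.lineGraph.adjMatrix ℂ *ᵥ y := by
    rw [mulVec_mulVec, transpose_incidence_mul, add_mulVec, smul_mulVec, one_mulVec,
      add_sub_cancel_left]
  rw [add_sub_assoc, hL]
  funext z
  rcases z with a | e
  · simp only [mulVec, dotProduct, Fintype.sum_sum_type, SimpleGraph.adjMatrix_apply, incidence,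
      Sum.elim_inl, Sum.elim_inr, of_apply, qGraph_adj_inl_inl, qGraph_adj_inl_inr, if_false,
      zero_mul, Finset.sum_const_zero, zero_add]
  · simp only [mulVec, dotProduct, Fintype.sum_sum_type, SimpleGraph.adjMatrix_apply, incidence,
      Sum.elim_inl, Sum.elim_inr, of_apply, qGraph_adj_inr_inl, qGraph_adj_inr_inr, Pi.add_apply,
      transpose_apply]

end

section

variable {V : Type*} [Fintype V] [DecidableEq V] (G : SimpleGraph V) [DecidableRel G.Adj]

theorem incidence_mul_transpose [Fintype G.edgeSet] :
    incidence G * (incidence G)ᵀ = Matrix.diagonal (fun a => (G.degree a : ℂ)) + G.adjMatrix ℂ := by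
  classical
  ext a b
  have hG := congrFun₂ (G.incMatrix_mul_transpose (R := ℂ)) a b
  rw [Matrix.mul_apply] at hG ⊢
  have : ∑ e : G.edgeSet, incidence G a e * (incidence G)ᵀ e b
      = ∑ e : Sym2 V, G.incMatrix ℂ a e * (G.incMatrix ℂ)ᵀ e b := by
    rw [← Finset.sum_subset (Finset.subset_univ G.edgeFinset),
      Finset.sum_subtype G.edgeFinset (fun e => SimpleGraph.mem_edgeFinset)]
    · refine Finset.sum_congr rfl fun e _ => ?_
      simp only [incidence, of_apply, transpose_apply, SimpleGraph.incMatrix_apply',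
        SimpleGraph.incidenceSet, Set.mem_ofPred_eq, e.2, true_and]
      congr
    · intro e _ he
      rw [SimpleGraph.incMatrix_of_notMem_incidenceSet, zero_mul]
      exact fun h => he (SimpleGraph.mem_edgeFinset.2 h.1)
  rw [this, hG]
  by_cases hab : a = b
  · subst hab; simp
  · simp [hab, SimpleGraph.adjMatrix_apply]

variable {G}

theorem incidence_mulVec_transpose_mulVec [Fintype G.edgeSet] {r : ℕ} (hreg : G.IsRegularOfDegree r)
    {w : V → ℂ} {l : ℂ} (hw : G.adjMatrix ℂ *ᵥ w = l • w) :
    incidence G *ᵥ ((incidence G)ᵀ *ᵥ w) = (l + r) • w := by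
  rw [mulVec_mulVec, incidence_mul_transpose, add_mulVec, hw]
  funext a
  simp [mulVec_diagonal, hreg.degree_eq a]
  ring

/-- An eigenvector of a regular graph `G` lifts to eigenvectors of `𝒬(G)`. -/
theorem adjMatrix_qGraph_mulVec_lift [Fintype G.edgeSet] {r : ℕ} (hreg : G.IsRegularOfDegree r)
    {w : V → ℂ} {l θ : ℂ} (hw : G.adjMatrix ℂ *ᵥ w = l • w)
    (hθ : θ ^ 2 - (l + r - 2) * θ - (l + r) = 0) :
    (qGraph G).adjMatrix ℂ *ᵥ Sum.elim ((θ - (l + r - 2)) • w) ((incidence G)ᵀ *ᵥ w)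
      = θ • Sum.elim ((θ - (l + r - 2)) • w) ((incidence G)ᵀ *ᵥ w) := by
  rw [adjMatrix_qGraph_mulVec, incidence_mulVec_transpose_mulVec hreg hw, mulVec_smul, mulVec_smul]
  funext z
  rcases z with a | e
  · simp only [Sum.elim_inl, Pi.smul_apply, smul_eq_mul]
    linear_combination -(w a) * hθ
  · simp only [Sum.elim_inr, Pi.smul_apply, Pi.add_apply, Pi.sub_apply, smul_eq_mul]
    ring

/-- The lifts for `θ` and `η` have the same edge part, so their difference is `(θ - η)` times `(w,
0)`. For `l = -r` one lift may be zero, which does no harm. -/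
theorem exp_adjMatrix_qGraph_mulVec_inl [Fintype G.edgeSet] {r : ℕ}
    (hreg : G.IsRegularOfDegree r) {w : V → ℂ} {l θ η : ℂ} (hw : G.adjMatrix ℂ *ᵥ w = l • w)
    (hsum : θ + η = l + r - 2) (hprod : θ * η = -(l + r)) (hne : θ ≠ η) (c : ℂ) (a : V) :
    (NormedSpace.exp (c • (qGraph G).adjMatrix ℂ) *ᵥ Sum.elim w 0) (Sum.inl a)
      = (θ * Complex.exp (c * η) - η * Complex.exp (c * θ)) / (θ - η) * w a := by
  have h1 := adjMatrix_qGraph_mulVec_lift (θ := θ) hreg hw (by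
    linear_combination -hprod + θ * hsum)
  have h2 := adjMatrix_qGraph_mulVec_lift (θ := η) hreg hw (by
    linear_combination -hprod + η * hsum)
  replace h1 := Matrix.exp_smul_mulVec_of_mulVec_eq _ c _ _ h1
  replace h2 := Matrix.exp_smul_mulVec_of_mulVec_eq _ c _ _ h2
  have h3 : (Sum.elim w 0 : V ⊕ G.edgeSet → ℂ) = (θ - η)⁻¹ •
      (Sum.elim ((θ - (l + r - 2)) • w) ((incidence G)ᵀ *ᵥ w) -
        Sum.elim ((η - (l + r - 2)) • w) ((incidence G)ᵀ *ᵥ w)) := by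
    have h0 : θ - η ≠ 0 := sub_ne_zero.2 hne
    funext z
    rcases z with a | e
    · simp; field_simp; ring
    · simp
  rw [h3, mulVec_smul, mulVec_sub, h1, h2]
  simp only [Pi.smul_apply, Pi.sub_apply, Sum.elim_inl, smul_eq_mul]
  rw [← hsum]
  have h0 : θ - η ≠ 0 := sub_ne_zero.2 hne
  field_simp
  ring

end

/-! ### Phases forced by PST, and a criterion for PGST on `𝒬(G)`. -/

section

variable {V : Type*} [Fintype V] [DecidableEq V] {G : SimpleGraph V} [DecidableRel G.Adj]

theorem exists_real_eigenbasis (G : SimpleGraph V) [DecidableRel G.Adj] :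
    ∃ (w : V → V → ℝ) (l : V → ℝ),
      (∀ i, G.adjMatrix ℂ *ᵥ (fun a => (w i a : ℂ)) = (l i : ℂ) • fun a => (w i a : ℂ)) ∧
      ∀ a b, ∑ i, w i a * w i b = if a = b then 1 else 0 := by
  have hA : (G.adjMatrix ℝ).IsHermitian := by
    rw [IsHermitian, conjTranspose_eq_transpose_of_trivial, SimpleGraph.transpose_adjMatrix]
  refine ⟨fun i a => hA.eigenvectorBasis i a, hA.eigenvalues, fun i => ?_, fun a b => ?_⟩
  · have h := hA.mulVec_eigenvectorBasis i
    funext a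
    have ha := congrArg (fun x : ℝ => (x : ℂ)) (congrFun h a)
    simp only [mulVec, dotProduct, Pi.smul_apply, smul_eq_mul, SimpleGraph.adjMatrix_apply] at ha ⊢
    rw [← Complex.ofReal_mul, ← ha]
    push_cast
    refine Finset.sum_congr rfl fun b _ => ?_
    split_ifs <;> simp
  · have h := hA.eigenvectorBasis.sum_inner_mul_inner (EuclideanSpace.single a 1)
      (EuclideanSpace.single b 1)
    simp only [EuclideanSpace.inner_single_left, EuclideanSpace.inner_single_right] at h
    simpa [Pi.single_apply, eq_comm] using h

/-- The values at the ends of a perfect state transfer of an eigenvector are proportional. -/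
theorem HasPST.exists_phase {u v : V} {t : ℝ} (h : HasPST G u v t) :
    ∃ c : ℂ, ∀ (w : V → ℂ) (l : ℂ), G.adjMatrix ℂ *ᵥ w = l • w →
      Complex.exp (-Complex.I * t * l) * w u = c * w v := by
  obtain ⟨c, -, hc⟩ := h
  refine ⟨c, fun w l hw => ?_⟩
  have h1 := Matrix.exp_smul_mulVec_of_mulVec_eq _ (-Complex.I * t) l w hw
  have hT : (transitionMatrix G t)ᵀ = transitionMatrix G t := by
    rw [transitionMatrix, ← Matrix.exp_transpose, transpose_smul, SimpleGraph.transpose_adjMatrix]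
  have h2 := congrArg (fun x => w ⬝ᵥ x) hc
  simp only [dotProduct_mulVec, dotProduct_smul, dotProduct_single, mul_one] at h2
  rw [← hT, vecMul_transpose, transitionMatrix, h1] at h2
  simpa using h2

theorem exp_int_mul_pi_mul_I (n : ℤ) :
    Complex.exp (n * (Real.pi * Complex.I)) = (-1) ^ n := by
  rw [Complex.exp_int_mul, Complex.exp_pi_mul_I]

/-- Perfect state transfer at time `π / g` forces `(r - l) / g` to be an integer for every eigenvalue
`l` in the support of `u`, since the eigenvectors are real; the gcd property of `g` is not needed. -/
theorem HasPST.exists_int_of_eigenvector {r : ℕ} (hreg : G.IsRegularOfDegree r) {u v : V} {g : ℕ}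
    (hg : g ≠ 0) (hpst : HasPST G u v (Real.pi / g)) {w : V → ℝ} {l : ℝ}
    (hw : G.adjMatrix ℂ *ᵥ (fun a => (w a : ℂ)) = (l : ℂ) • fun a => (w a : ℂ)) (hu : w u ≠ 0) :
    ∃ K : ℤ, l + r = ((2 * r - g * K : ℤ) : ℝ) ∧ w v = (-1) ^ K * w u := by
  obtain ⟨c, hc⟩ := hpst.exists_phase
  -- The all-ones eigenvector determines the phase `c`.
  have h1 := hc (fun _ => 1) r (by
    funext a
    simp [SimpleGraph.adjMatrix_mulVec_apply, hreg.degree_eq a])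
  have h2 := hc _ _ hw
  rw [mul_one, mul_one] at h1
  rw [← h1] at h2
  have hg' : (g : ℝ) ≠ 0 := by exact_mod_cast hg
  have h3 : (w v : ℂ) = Complex.exp ((Real.pi / g * (r - l) : ℝ) * Complex.I) * w u := by
    have h4 : Complex.exp ((Real.pi / g * (r - l) : ℝ) * Complex.I)
        = Complex.exp (-Complex.I * (Real.pi / g : ℝ) * l) *
          Complex.exp (-(-Complex.I * (Real.pi / g : ℝ) * r)) := by
      rw [← Complex.exp_add]; congr 1; push_cast; ring
    rw [h4, mul_right_comm, h2, mul_right_comm, ← Complex.exp_add, add_neg_cancel, Complex.exp_zero,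
      one_mul]
  have h5 : Real.sin (Real.pi / g * (r - l)) = 0 := by
    have := congrArg Complex.im h3
    rw [Complex.ofReal_im, Complex.mul_im, Complex.ofReal_im, Complex.exp_ofReal_mul_I_im, mul_zero,
      zero_add, Complex.ofReal_re] at this
    exact (mul_eq_zero.1 this.symm).resolve_right hu
  obtain ⟨K, hK⟩ := Real.sin_eq_zero_iff.1 h5
  refine ⟨K, ?_, ?_⟩
  · have : (K : ℝ) * g = r - l := by
      have hpi := Real.pi_ne_zero
      field_simp at hK
      linarith
    push_cast
    linarith
  · rw [← hK] at h3
    push_cast at h3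
    rw [mul_assoc, exp_int_mul_pi_mul_I] at h3
    apply Complex.ofReal_injective
    push_cast
    exact h3

open scoped ComplexOrder in
-- Here `R Rᵀ w = 0`, hence `Rᵀ w = 0`: `w` changes sign along each edge. By connectedness it
-- vanishes nowhere, so its sign is a 2-colouring.
theorem isBipartite_of_eigenvector_neg {r : ℕ} (hconn : G.Connected)
    (hreg : G.IsRegularOfDegree r)
    {w : V → ℝ} {l : ℝ}
    (hw : G.adjMatrix ℂ *ᵥ (fun a => (w a : ℂ)) = (l : ℂ) • fun a => (w a : ℂ)) {u : V} (hu : w u ≠ 0) (hl : l + r = 0) : G.IsBipartite := by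
  have hR : (incidence G)ᵀ = (incidence G)ᴴ := by
    ext e a
    simp only [incidence, transpose_apply, conjTranspose_apply, of_apply]
    split_ifs <;> simp
  have h1 := incidence_mulVec_transpose_mulVec hreg hw
  rw [show ((l : ℂ) + r) = 0 by exact_mod_cast hl, zero_smul, mulVec_mulVec, hR,
    self_mul_conjTranspose_mulVec_eq_zero, ← hR] at h1
  have hadj : ∀ p q, G.Adj p q → w p + w q = 0 := fun p q hpq => by
    have h2 := congrFun h1 ⟨s(p, q), hpq⟩
    simp only [mulVec, dotProduct, transpose_apply] at h2
    rw [sum_incidence_mul G _ _ rfl, Pi.zero_apply] at h2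
    exact_mod_cast h2
  have hne : ∀ a, w a ≠ 0 := fun a => by
    obtain ⟨p⟩ := hconn.preconnected a u
    induction p with
    | nil => exact hu
    | cons h _ ih =>
      intro h0
      have := hadj _ _ h
      rw [h0, zero_add] at this
      exact ih hu this
  let C : G.Coloring Bool := SimpleGraph.Coloring.mk (fun a => decide (0 < w a)) (by
    intro p q hpq heq
    have h2 := hadj p q hpq
    have h3 := hne p
    rw [decide_eq_decide] at heq
    rcases lt_or_gt_of_ne h3 with h | h
    · have := heq.2 (by linarith)
      linarith
    · have := heq.1 h
      linarith)
  exact C.colorable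

theorem transitionMatrix_qGraph_inl_inl {r : ℕ} (hreg : G.IsRegularOfDegree r) {w : V → V → ℝ}
    {l : V → ℝ}
    (hw : ∀ i, G.adjMatrix ℂ *ᵥ (fun a => (w i a : ℂ)) = (l i : ℂ) • fun a => (w i a : ℂ))
    (hb : ∀ a b, ∑ i, w i a * w i b = if a = b then 1 else 0) (θ η : V → ℂ)
    (hsum : ∀ i, θ i + η i = l i + r - 2) (hprod : ∀ i, θ i * η i = -(l i + r))
    (hne : ∀ i, θ i ≠ η i) (t : ℝ) (u v : V) :
    transitionMatrix (qGraph G) t (Sum.inl u) (Sum.inl v) = ∑ i, w i v *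
      ((θ i * Complex.exp (-Complex.I * t * η i) - η i * Complex.exp (-Complex.I * t * θ i)) /
        (θ i - η i) * w i u) := by
  have h1 : (Pi.single (Sum.inl v) 1 : V ⊕ G.edgeSet → ℂ)
      = ∑ i, (w i v : ℂ) • Sum.elim (fun a => (w i a : ℂ)) 0 := by
    funext z
    rcases z with a | e
    · have := congrArg (fun x : ℝ => (x : ℂ)) (hb v a)
      simp only [Finset.sum_apply, Pi.smul_apply, Sum.elim_inl, smul_eq_mul, Pi.single_apply,
        Sum.inl.injEq]
      push_cast at this
      rw [this]
      by_cases hva : v = a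
      · simp [hva]
      · simp [hva, Ne.symm hva]
    · simp
  have h2 : transitionMatrix (qGraph G) t (Sum.inl u) (Sum.inl v)
      = (transitionMatrix (qGraph G) t *ᵥ Pi.single (Sum.inl v) 1) (Sum.inl u) := by
    rw [mulVec_single_one]; rfl
  rw [h2, h1, mulVec_sum, Finset.sum_apply]
  refine Finset.sum_congr rfl fun i _ => ?_
  rw [mulVec_smul, Pi.smul_apply, smul_eq_mul, transitionMatrix,
    exp_adjMatrix_qGraph_mulVec_inl hreg (hw i) (hsum i) (hprod i) (hne i)]

/-- The weights of `x` and `y` sum to `1`, and each is at most `3/2` in absolute value because `|m -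
2| ≤ 2√(m² + 4)`. -/
theorem norm_combination_sub_le {m δ : ℝ} {x y z : ℂ}
    (hx : ‖x - z‖ ≤ δ) (hy : ‖y - z‖ ≤ δ) :
    ‖((((m - 2 + √(m ^ 2 + 4)) / 2 : ℝ) : ℂ) * x - (((m - 2 - √(m ^ 2 + 4)) / 2 : ℝ) : ℂ) * y) /
      ((((m - 2 + √(m ^ 2 + 4)) / 2 : ℝ) : ℂ) - (((m - 2 - √(m ^ 2 + 4)) / 2 : ℝ) : ℂ)) - z‖
      ≤ 3 * δ := by
  set s := √(m ^ 2 + 4) with hs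
  have hs2 : s ^ 2 = m ^ 2 + 4 := Real.sq_sqrt (by positivity)
  have hs0 : 0 < s := Real.sqrt_pos.2 (by positivity)
  have hm : |m - 2| ≤ 2 * s := by
    refine abs_le_of_sq_le_sq (by nlinarith [sq_nonneg (m + 2)]) (by positivity)
  have hδ : 0 ≤ δ := (norm_nonneg _).trans hx
  set a := (m - 2 + s) / 2 with ha
  set b := (m - 2 - s) / 2 with hb
  have hab : (a : ℂ) - b = s := by rw [← Complex.ofReal_sub, ha, hb]; congr 1; ring
  have hsc : (s : ℂ) ≠ 0 := by exact_mod_cast hs0.ne'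
  have h1 : ((a : ℂ) * x - b * y) / (a - b) - z = (a * (x - z) - b * (y - z)) / s := by
    rw [hab]; field_simp; rw [← hab]; ring
  rw [h1, norm_div, Complex.norm_real, Real.norm_of_nonneg hs0.le, div_le_iff₀ hs0]
  have h2 : |a| ≤ 3 / 2 * s := by
    obtain ⟨h3, h4⟩ := abs_le.1 hm
    rw [abs_le]; constructor <;> linarith
  have h2' : |b| ≤ 3 / 2 * s := by
    obtain ⟨h3, h4⟩ := abs_le.1 hm
    rw [abs_le]; constructor <;> linarith
  calc ‖(a : ℂ) * (x - z) - b * (y - z)‖ ≤ |a| * ‖x - z‖ + |b| * ‖y - z‖ := by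
        refine (norm_sub_le _ _).trans_eq ?_
        simp
    _ ≤ 3 / 2 * s * δ + 3 / 2 * s * δ := by gcongr
    _ = 3 * δ * s := by ring

theorem norm_exp_sub_le {x δ : ℝ} {κ n : ℤ} (h : |x - κ / 2 - n| < δ) :
    ‖Complex.exp (2 * Real.pi * x * Complex.I) - (-1) ^ κ‖ ≤ 2 * Real.pi * δ := by
  have h1 : Complex.exp (2 * Real.pi * x * Complex.I) - (-1) ^ κ
      = (-1) ^ κ * (Complex.exp (Complex.I * (2 * Real.pi * (x - κ / 2 - n) : ℝ)) - 1) := by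
    rw [mul_sub, mul_one, ← exp_int_mul_pi_mul_I, ← Complex.exp_add]
    congr 1
    rw [Complex.exp_eq_exp_iff_exists_int]
    exact ⟨n, by push_cast; ring⟩
  rw [h1, norm_mul, norm_zpow, norm_neg, norm_one, _root_.one_zpow, one_mul]
  refine (Real.norm_exp_I_mul_ofReal_sub_one_le).trans ?_
  rw [Real.norm_eq_abs, abs_mul, abs_of_pos Real.two_pi_pos]
  gcongr

/-- A sufficient condition for pretty good state transfer on `𝒬(G)`, in terms of the eigenvalues
`l i` of `G`, with `m i = l i + r`. -/
theorem hasPGST_qGraph_of_approx {r : ℕ} (hreg : G.IsRegularOfDegree r) {w : V → V → ℝ}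
    {l : V → ℝ}
    (hw : ∀ i, G.adjMatrix ℂ *ᵥ (fun a => (w i a : ℂ)) = (l i : ℂ) • fun a => (w i a : ℂ))
    (hb : ∀ a b, ∑ i, w i a * w i b = if a = b then 1 else 0) {u v : V} {K : V → ℤ}
    (hK : ∀ i, w i u ≠ 0 → w i v = (-1) ^ K i * w i u)
    (happ : ∀ δ : ℝ, 0 < δ → ∃ (t : ℝ) (γ : ℂ), ‖γ‖ = 1 ∧ ∀ i, w i u ≠ 0 → ∃ κ n : ℤ,
      |t * √((l i + r) ^ 2 + 4) / (4 * Real.pi) - κ / 2 - n| < δ ∧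
      Complex.exp (-Complex.I * t * ((l i + r - 2) / 2)) = γ * (-1) ^ (K i + κ)) :
    HasPGST (qGraph G) (Sum.inl u) (Sum.inl v) := by
  intro ε hε
  have hpi := Real.pi_pos
  -- The factor `2π` of `norm_exp_sub_le` and the factor `3` of `norm_combination_sub_le` turn this
  -- tolerance into `ε / 2`.
  obtain ⟨t, γ, hγ, ht⟩ := happ (ε / (12 * Real.pi)) (by positivity)
  refine ⟨t, ?_⟩
  let θ : V → ℂ := fun i => (((l i + r) - 2 + √((l i + r) ^ 2 + 4)) / 2 : ℝ)
  let η : V → ℂ := fun i => (((l i + r) - 2 - √((l i + r) ^ 2 + 4)) / 2 : ℝ)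
  have hs : ∀ i, 0 < √((l i + r) ^ 2 + 4) := fun i => Real.sqrt_pos.2 (by positivity)
  have hsq : ∀ i, √((l i + r) ^ 2 + 4) ^ 2 = (l i + r) ^ 2 + 4 := fun i =>
    Real.sq_sqrt (by positivity)
  have hT := transitionMatrix_qGraph_inl_inl hreg hw hb θ η
    (fun i => by simp only [θ, η]; push_cast; ring)
    (fun i => by
      have h := congrArg (fun x : ℝ => (x : ℂ)) (hsq i)
      simp only [θ, η]
      push_cast at h ⊢
      linear_combination -h / 4)
    (fun i h => by
      have := Complex.ofReal_injective h
      linarith [hs i]) t u v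
  have hone : ∑ i, w i u * w i u = 1 := by simpa using hb u u
  have hphase : ∀ i, w i u ≠ 0 → ∀ σ : ℝ, (σ = 1 ∨ σ = -1) →
      ‖Complex.exp (-Complex.I * t * (((l i + r) - 2 + σ * √((l i + r) ^ 2 + 4)) / 2 : ℝ))
        - γ * (-1) ^ K i‖ ≤ ε / 6 := by
    intro i hi σ hσ
    obtain ⟨κ, n, h1, h2⟩ := ht i hi
    have h3 : Complex.exp (-Complex.I * t * (((l i + r) - 2 + σ * √((l i + r) ^ 2 + 4)) / 2 : ℝ))
        = γ * (-1) ^ (K i + κ) * Complex.exp (2 * Real.pi *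
          ((-σ * (t * √((l i + r) ^ 2 + 4) / (4 * Real.pi)) : ℝ) : ℂ) * Complex.I) := by
      rw [← h2, ← Complex.exp_add]
      congr 1
      have : (Real.pi : ℂ) ≠ 0 := by exact_mod_cast hpi.ne'
      push_cast
      field_simp
      ring
    have hκ : ((-1 : ℂ) ^ κ) * (-1) ^ κ = 1 := by
      rw [← mul_zpow]; simp
    have h4 : γ * (-1) ^ K i = γ * (-1) ^ (K i + κ) * (-1) ^ κ := by
      rw [zpow_add₀ (by norm_num)]
      linear_combination -(γ * (-1) ^ K i) * hκ
    rw [h3, h4, ← mul_sub, norm_mul, norm_mul, hγ, norm_zpow, norm_neg, norm_one, _root_.one_zpow, one_mul,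
      one_mul]
    have h5 : 2 * Real.pi * (ε / (12 * Real.pi)) = ε / 6 := by field_simp; norm_num
    rw [← h5]
    rcases hσ with rfl | rfl
    -- Negation sends `κ/2` to `-κ/2 = κ/2 - κ`, the same target modulo `1`.
    · refine norm_exp_sub_le (κ := κ) (n := -κ - n) ?_
      rw [← abs_neg] at h1
      convert h1 using 2
      push_cast; ring
    · refine norm_exp_sub_le (κ := κ) (n := n) ?_
      convert h1 using 2
      ring
  have hterm : ‖transitionMatrix (qGraph G) t (Sum.inl u) (Sum.inl v) - γ‖ ≤ ε / 2 := by
    have h1 : γ = ∑ i, γ * (w i u * w i u : ℝ) := by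
      rw [← Finset.mul_sum, ← Complex.ofReal_sum, hone]; simp
    have h2 : ε / 2 = ∑ i, (ε / 2) * (w i u * w i u) := by
      rw [← Finset.mul_sum, hone, mul_one]
    rw [hT]
    conv_lhs => rw [h1]
    rw [← Finset.sum_sub_distrib, h2]
    refine norm_sum_le_of_le _ fun i _ => ?_
    by_cases hi : w i u = 0
    · simp [hi]
    have hx := hphase i hi (-1) (Or.inr rfl)
    have hy := hphase i hi 1 (Or.inl rfl)
    rw [neg_one_mul, ← sub_eq_add_neg] at hx
    rw [one_mul] at hy
    have h3 := norm_combination_sub_le (m := l i + r) hx hy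
    have hκ : ((-1 : ℂ) ^ K i) * (-1) ^ K i = 1 := by
      rw [← mul_zpow]; simp
    set F : ℂ := (θ i * Complex.exp (-Complex.I * t * η i) -
      η i * Complex.exp (-Complex.I * t * θ i)) / (θ i - η i) with hF
    replace h3 : ‖F - γ * (-1) ^ K i‖ ≤ 3 * (ε / 6) := h3
    have h4 : (w i v : ℂ) * (F * w i u) - γ * (w i u * w i u : ℝ)
        = (-1) ^ K i * (F - γ * (-1) ^ K i) * (w i u * w i u : ℝ) := by
      rw [hK i hi]
      push_cast
      linear_combination (γ * w i u * w i u) * hκ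
    rw [h4, norm_mul, norm_mul, norm_zpow, norm_neg, norm_one, _root_.one_zpow, one_mul, Complex.norm_real,
      Real.norm_of_nonneg (mul_self_nonneg _)]
    refine mul_le_mul_of_nonneg_right (h3.trans_eq (by ring)) (mul_self_nonneg _)
  have h1 : ‖γ‖ - ‖transitionMatrix (qGraph G) t (Sum.inl u) (Sum.inl v)‖ ≤ ε / 2 := by
    refine (norm_sub_norm_le _ _).trans ?_
    rw [norm_sub_rev]; exact hterm
  rw [hγ] at h1
  linarith

end

/-! ### Reduction to the choice of a time, and the three choices. -/

theorem HasPGST.refl {V : Type*} [Fintype V] [DecidableEq V] (G : SimpleGraph V)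
    [DecidableRel G.Adj] (u : V) : HasPGST G u u := by
  intro ε hε
  refine ⟨0, ?_⟩
  simp [transitionMatrix, hε]

theorem HasPST.eq_of_time_zero {V : Type*} [Fintype V] [DecidableEq V] {G : SimpleGraph V}
    [DecidableRel G.Adj] {u v : V} (h : HasPST G u v 0) : u = v := by
  obtain ⟨c, -, hc⟩ := h
  by_contra huv
  have := congrFun hc u
  simp [transitionMatrix, huv] at this

/-- Reduction of pretty good state transfer on `𝒬(G)` to the choice of a time `t` that approximates
the right phases for all eigenvalues `r - g K` with `K` in a given finite set. -/
theorem hasPGST_qGraph_of_hasPST {V : Type*} [Fintype V] [DecidableEq V] {G : SimpleGraph V}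
    [DecidableRel G.Adj] {r : ℕ} (hreg : G.IsRegularOfDegree r) {u v : V} {g : ℕ}
    (hpst : HasPST G u v (Real.pi / g))
    (happ : g ≠ 0 → ∀ M : Finset ℤ,
      (∀ K ∈ M, ∃ (w : V → ℝ) (l : ℝ), w u ≠ 0 ∧ l + r = ((2 * r - g * K : ℤ) : ℝ) ∧
        G.adjMatrix ℂ *ᵥ (fun a => (w a : ℂ)) = (l : ℂ) • fun a => (w a : ℂ)) →
      ∀ δ : ℝ, 0 < δ → ∃ (t : ℝ) (γ : ℂ), ‖γ‖ = 1 ∧ ∀ K ∈ M, ∃ κ n : ℤ,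
        |t * √(((2 * r - g * K : ℤ) : ℝ) ^ 2 + 4) / (4 * Real.pi) - κ / 2 - n| < δ ∧
        Complex.exp (-Complex.I * t * (((2 * r - g * K : ℤ) - 2) / 2)) = γ * (-1) ^ (K + κ)) :
    HasPGST (qGraph G) (Sum.inl u) (Sum.inl v) := by
  -- With `π / 0 = 0` the transfer takes place at time `0`, so `u = v`.
  by_cases hg : g = 0
  · subst hg
    rw [Nat.cast_zero, div_zero] at hpst
    rw [hpst.eq_of_time_zero]
    exact HasPGST.refl _ _
  obtain ⟨w, l, hw, hb⟩ := exists_real_eigenbasis G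
  have hex : ∀ i, ∃ K : ℤ, w i u ≠ 0 → l i + r = ((2 * r - g * K : ℤ) : ℝ) ∧
      w i v = (-1) ^ K * w i u := fun i => by
    by_cases hi : w i u = 0
    · exact ⟨0, fun h => absurd hi h⟩
    · obtain ⟨K, hK⟩ := hpst.exists_int_of_eigenvector hreg hg (hw i) hi
      exact ⟨K, fun _ => hK⟩
  choose K hK using hex
  refine hasPGST_qGraph_of_approx hreg hw hb (fun i hi => (hK i hi).2) fun δ hδ => ?_
  obtain ⟨t, γ, hγ, h⟩ := happ hg ((Finset.univ.filter fun i => w i u ≠ 0).image K) (by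
    intro k hk
    obtain ⟨i, hi, rfl⟩ := Finset.mem_image.1 hk
    have hi' := (Finset.mem_filter.1 hi).2
    exact ⟨w i, l i, hi', (hK i hi').1, hw i⟩) δ hδ
  refine ⟨t, γ, hγ, fun i hi => ?_⟩
  obtain ⟨κ, n, h1, h2⟩ := h (K i) (Finset.mem_image_of_mem _ (by simp [hi]))
  refine ⟨κ, n, ?_, ?_⟩
  · rw [(hK i hi).1]; exact h1
  · have h3 := congrArg (fun x : ℝ => (x : ℂ)) (hK i hi).1
    push_cast at h3 h2
    rw [h3]; exact h2

/-- At `t = 2π(2p+1)/g` the first phase is `γ (-1)^K` exactly, as `2p + 1` is odd; so `κ = 0`. -/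
theorem exists_time_of_ne_zero {r g : ℕ} (hg : g ≠ 0) (M : Finset ℤ)
    (hM : ∀ K ∈ M, 2 * (r : ℤ) - g * K ≠ 0) {δ : ℝ} (hδ : 0 < δ) :
    ∃ (t : ℝ) (γ : ℂ), ‖γ‖ = 1 ∧ ∀ K ∈ M, ∃ κ n : ℤ,
      |t * √(((2 * r - g * K : ℤ) : ℝ) ^ 2 + 4) / (4 * Real.pi) - κ / 2 - n| < δ ∧
      Complex.exp (-Complex.I * t * (((2 * r - g * K : ℤ) - 2) / 2)) = γ * (-1) ^ (K + κ) := by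
  obtain ⟨p, hp⟩ := exists_odd_mul_sqrt_near_int (M.image fun K => 2 * (r : ℤ) - g * K) hg (by
    intro m hm h0
    obtain ⟨K, hK, rfl⟩ := Finset.mem_image.1 hm
    exact absurd h0 (hM K hK)) hδ
  have hg' : (g : ℂ) ≠ 0 := by exact_mod_cast hg
  refine ⟨2 * Real.pi * (2 * p + 1) / g,
    Complex.exp ((-(Real.pi * (2 * p + 1) * (2 * r - 2) / g) : ℝ) * Complex.I),
    Complex.norm_exp_ofReal_mul_I _, fun K hK => ?_⟩
  obtain ⟨n, hn⟩ := hp _ (Finset.mem_image_of_mem _ hK)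
  refine ⟨0, n, ?_, ?_⟩
  · convert hn using 2
    have := Real.pi_ne_zero
    have hg'' : (g : ℝ) ≠ 0 := by exact_mod_cast hg
    push_cast
    field_simp
    ring
  · have h1 : ((-1 : ℂ)) ^ (K + 0) = (-1) ^ ((2 * p + 1) * K : ℤ) := by
      rw [add_zero, _root_.zpow_mul, Odd.neg_one_zpow (n := 2 * (p : ℤ) + 1) ⟨p, rfl⟩]
    rw [h1, ← exp_int_mul_pi_mul_I, ← Complex.exp_add]
    congr 1
    push_cast
    field_simp
    ring

/-- Here `m = 0` may occur, so `t = 2π(2p+1)` without the divisor `g`: at `m = 0` the scaled root is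
the integer `2p + 1`. As `g` is odd, `gK` keeps the parity of `K`. -/
theorem exists_time_of_odd {r g j : ℕ} (hg : Odd g) (hr : r = 2 * j * g) (M : Finset ℤ) {δ : ℝ}
    (hδ : 0 < δ) :
    ∃ (t : ℝ) (γ : ℂ), ‖γ‖ = 1 ∧ ∀ K ∈ M, ∃ κ n : ℤ,
      |t * √(((2 * r - g * K : ℤ) : ℝ) ^ 2 + 4) / (4 * Real.pi) - κ / 2 - n| < δ ∧
      Complex.exp (-Complex.I * t * (((2 * r - g * K : ℤ) - 2) / 2)) = γ * (-1) ^ (K + κ) := by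
  obtain ⟨p, hp⟩ := exists_odd_mul_sqrt_near_int (M.image fun K => 2 * (r : ℤ) - g * K) one_ne_zero
    (fun _ _ _ => rfl) hδ
  refine ⟨2 * Real.pi * (2 * p + 1), 1, norm_one, fun K hK => ?_⟩
  obtain ⟨n, hn⟩ := hp _ (Finset.mem_image_of_mem _ hK)
  refine ⟨0, n, ?_, ?_⟩
  · convert hn using 2
    have := Real.pi_ne_zero
    push_cast
    field_simp
    ring
  · obtain ⟨c, rfl⟩ := hg
    have h1 : Complex.exp (-Complex.I * ((2 * Real.pi * (2 * p + 1) : ℝ) : ℂ) *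
        (((2 * r - (2 * c + 1 : ℕ) * K : ℤ) - 2) / 2))
        = Complex.exp ((((2 * p + 1) * (K + 2 * (c * K + 1 - 2 * j * (2 * c + 1))) : ℤ)) *
          (Real.pi * Complex.I)) := by
      congr 1
      rw [hr]
      push_cast
      ring
    rw [h1, exp_int_mul_pi_mul_I, _root_.zpow_mul, Odd.neg_one_zpow (n := 2 * (p : ℤ) + 1) ⟨p, rfl⟩,
      zpow_add₀ (by norm_num), _root_.zpow_mul]
    simp

/-- Now `m = 2hk` with `k = 4j - K` is even, so `t = 2πq` makes the first phase `1` and the sign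
must come from the square root: `κ = k` has the parity of `K`, and `√(m² + 4) = 2√((hk)² + 1)`. -/
theorem exists_time_of_even {r h j : ℕ} (hh : h ≠ 0) (hr : r = 2 * j * (2 * h)) (M : Finset ℤ)
    {δ : ℝ} (hδ : 0 < δ) :
    ∃ (t : ℝ) (γ : ℂ), ‖γ‖ = 1 ∧ ∀ K ∈ M, ∃ κ n : ℤ,
      |t * √(((2 * r - (2 * h : ℕ) * K : ℤ) : ℝ) ^ 2 + 4) / (4 * Real.pi) - κ / 2 - n| < δ ∧
      Complex.exp (-Complex.I * t * (((2 * r - (2 * h : ℕ) * K : ℤ) - 2) / 2))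
        = γ * (-1) ^ (K + κ) := by
  obtain ⟨q, hq⟩ := exists_mul_sqrt_near_half (M.image fun K => 4 * (j : ℤ) - K) hh hδ
  refine ⟨2 * Real.pi * q, 1, norm_one, fun K hK => ?_⟩
  obtain ⟨n, hn⟩ := hq _ (Finset.mem_image_of_mem _ hK)
  refine ⟨4 * j - K, n, ?_, ?_⟩
  · convert hn using 2
    have hpi := Real.pi_ne_zero
    have h1 : ((2 * r - (2 * h : ℕ) * K : ℤ) : ℝ) ^ 2 + 4
        = 2 ^ 2 * ((h * ((4 * j - K : ℤ) : ℝ)) ^ 2 + 1) := by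
      rw [hr]; push_cast; ring
    rw [h1, Real.sqrt_mul (by positivity), Real.sqrt_sq (by norm_num)]
    field_simp
    ring
  · have h1 : Complex.exp (-Complex.I * ((2 * Real.pi * q : ℝ) : ℂ) *
        (((2 * r - (2 * h : ℕ) * K : ℤ) - 2) / 2))
        = Complex.exp ((2 * (q * (1 + h * K - 4 * j * h)) : ℤ) * (Real.pi * Complex.I)) := by
      congr 1
      rw [hr]
      push_cast
      ring
    rw [h1, exp_int_mul_pi_mul_I, _root_.zpow_mul, add_sub_cancel,
      show (4 * j : ℤ) = 2 * (2 * j) by ring, _root_.zpow_mul (-1 : ℂ) 2 (2 * j)]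
    simp

end QWalk

theorem theorem5p1 {V : Type*} [Fintype V] [DecidableEq V] (G : SimpleGraph V)
    [DecidableRel G.Adj] (r : ℕ) (hr : 2 ≤ r) (hconn : G.Connected)
    (hreg : G.IsRegularOfDegree r) (u v : V) (g : ℕ) (hg : QWalk.IsCoutinhoGcd G u g)
    (hpst : QWalk.HasPST G u v (Real.pi / (g : ℝ))) :
    (¬ G.IsBipartite → QWalk.HasPGST (QWalk.qGraph G) (Sum.inl u) (Sum.inl v)) ∧
    (G.IsBipartite → (∃ k : ℤ, Even k ∧ (r : ℝ) / (g : ℝ) = (k : ℝ)) →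
      QWalk.HasPGST (QWalk.qGraph G) (Sum.inl u) (Sum.inl v)) := by
  refine ⟨fun hnb => ?_, fun _ hk => ?_⟩
  · refine QWalk.hasPGST_qGraph_of_hasPST hreg hpst fun hg0 M hM δ hδ =>
      QWalk.exists_time_of_ne_zero hg0 M (fun K hK h0 => hnb ?_) hδ
    obtain ⟨w, l, hu, hl, hw⟩ := hM K hK
    rw [h0, Int.cast_zero] at hl
    exact QWalk.isBipartite_of_eigenvector_neg hconn hreg hw hu hl
  · refine QWalk.hasPGST_qGraph_of_hasPST hreg hpst fun hg0 M _ δ hδ => ?_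
    obtain ⟨k, ⟨j, rfl⟩, hj⟩ := hk
    have hgpos : (0 : ℝ) < g := by exact_mod_cast Nat.pos_of_ne_zero hg0
    have hj0 : 0 ≤ j := by
      have h1 : (0 : ℝ) ≤ ((j + j : ℤ) : ℝ) := by rw [← hj]; positivity
      have h2 : 0 ≤ j + j := by exact_mod_cast h1
      omega
    lift j to ℕ using hj0
    have hrg : r = 2 * j * g := by
      rw [div_eq_iff hgpos.ne'] at hj
      have h1 : (r : ℝ) = ((2 * j * g : ℕ) : ℝ) := by rw [hj]; push_cast; ring
      exact_mod_cast h1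
    rcases Nat.even_or_odd g with he | ho
    · obtain ⟨h, rfl⟩ := even_iff_exists_two_mul.1 he
      exact QWalk.exists_time_of_even (by rintro rfl; simp at hg0) hrg M hδ
    · exact QWalk.exists_time_of_odd ho hrg M hδ
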